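/- \textbf{Theorem (Quantum de Finetti).} Let $D,n,k$ be non-negative integers with $n\ge 1$. For $\pi\in S_m$ let $P_\pi$ be the operator on $(\mathbb C^d)^{\otimes m}$ with $P_\pi|i_1\rangle\otimes\cdots\otimes|i_m\rangle=|i_{\pi^{-1}(1)}\rangle\otimes\cdots\otimes|i_{\pi^{-1}(m)}\rangle$, and let $\mathrm{Sym}^m(\mathbb C^d)$ be the space of vectors fixed by all $P_\pi$. Write $\|X\|_1=\mathrm{tr}\sqrt{X^\dagger X}$, let $\mathrm{tr}_n$ be the partial trace over the last $n$ of $k+n$ systems, let $d\phi$ be the uniform probability measure on the unit vectors of $\mathbb C^D$, and put $$F(d,n,k)=\binom{d+n-1}{d-1}\Big/\binom{d+n+k-1}{d-1}.$$ (1) Let $|\psi\rangle\in \mathrm{Sym}^{n+k}(\mathbb C^D)$ be a unit vector. For a unit vector $\phi\in\mathbb C^D$ put $$|\tilde v_\phi\rangle=\binom{D+n-1}{D-1}^{1/2}\bigl(I^{\otimes k}\otimes\langle\phi|^{\otimes n}\bigr)|\psi\rangle,\qquad p_\phi=\langle \tilde v_\phi|\tilde v_\phi\rangle .$$ Then $p_\phi\,d\phi$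 is a probability measure, and there are unit vectors $|v_\phi\rangle\in(\mathbb C^D)^{\otimes k}$, depending measurably on $\phi$, with $|\tilde v_\phi\rangle=\sqrt{p_\phi}\,|v_\phi\rangle$ for all $\phi$, $$\mathrm{tr}_n|\psi\rangle\langle\psi|=\int d\phi\;p_\phi\,|v_\phi\rangle\langle v_\phi|,\qquad \int d\phi\;p_\phi\,\bigl|\langle v_\phi|\phi^{\otimes k}\rangle\bigr|^2=F(D,n,k)\ \ge\ 1-\frac{kD}{n}.$$ Moreover, if $\mu$ is the law of the density matrix $\sigma=|\phi\rangle\langle\phi|$ for $\phi$ distributed according to $p_\phi\,d\phi$ (a probability measure on the density matrices on $\mathbb C^D$), then $$\frac12\Bigl\|\,\mathrm{tr}_n|\psi\rangle\langle\psi|-\int d\mu(\sigma)\,\sigma^{\otimes k}\Bigr\|_1\ \le\ \sqrt{1-F(D,n,k)}\ ,$$ and in particular the left-hand side is at most $\sqrt{kD/n}$. (2) Let $\rho$ be a density matrix on $(\mathbb C^D)^{\otimes (n+k)}$ with $P_\pi\rho P_\pi^\dagger=\rho$ for all $\pi\in S_{n+k}$. Then $\rho$ has a purification in the symmetric subspace: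 there is a unit vector $|\Psi\rangle\in\mathrm{Sym}^{n+k}(\mathbb C^D\otimes\mathbb C^D)$ such that tracing out the second factor of each of the $n+k$ systems from $|\Psi\rangle\langle\Psi|$ gives $\rho$. Moreover, there is a probability measure $\mu$ on the density matrices on $\mathbb C^D$ with $$\frac12\Bigl\|\,\mathrm{tr}_n\rho-\int d\mu(\sigma)\,\sigma^{\otimes k}\Bigr\|_1\ \le\ \sqrt{1-F(D^2,n,k)}\ ,$$ and in particular the left-hand side is at most $\sqrt{kD^2/n}$. -/

import Mathlib

open MeasureTheory
open scoped MatrixOrder ComplexOrder ComplexConjugate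

noncomputable section

namespace DeFinetti

/-- The Hilbert space `(ℂ^d)^{⊗ m}`, in coordinates with respect to the product basis
`|x₁⟩ ⊗ ⋯ ⊗ |x_m⟩`, where `x : Fin m → d`. -/
abbrev Tensors (d : Type*) [Fintype d] (m : ℕ) : Type _ := EuclideanSpace ℂ (Fin m → d)

/-- The product vector `|φ⟩^{⊗ m}`. -/
def tensorPow {d : Type*} [Fintype d] (φ : EuclideanSpace ℂ d) (m : ℕ) : Tensors d m :=
  WithLp.toLp 2 fun x => ∏ i, φ (x i)

/-- The matrix `A^{⊗ m}`. -/
def matTensorPow {d : Type*} (A : Matrix d d ℂ) (m : ℕ) : Matrix (Fin m → d) (Fin m → d) ℂ :=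
  Matrix.of fun x y => ∏ i, A (x i) (y i)

/-- The rank-one operator `|ψ⟩⟨ψ|`. -/
def proj {ι : Type*} (ψ : EuclideanSpace ℂ ι) : Matrix ι ι ℂ :=
  Matrix.of fun x y => ψ x * conj (ψ y)

/-- The permutation operator `P_π` on `(ℂ^d)^{⊗ m}`:
`P_π |x₁⟩ ⊗ ⋯ ⊗ |x_m⟩ = |x_{π⁻¹(1)}⟩ ⊗ ⋯ ⊗ |x_{π⁻¹(m)}⟩`. -/
def permOp (d : Type*) [DecidableEq d] {m : ℕ} (π : Equiv.Perm (Fin m)) :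
    Matrix (Fin m → d) (Fin m → d) ℂ :=
  Matrix.of fun y x => if y = (fun i => x (π⁻¹ i)) then 1 else 0

/-- The symmetric subspace `Sym^m(ℂ^d)`: the vectors fixed by all `P_π`. -/
def symSubspace (d : Type*) [Fintype d] [DecidableEq d] (m : ℕ) : Submodule ℂ (Tensors d m) where
  carrier := {ψ | ∀ π : Equiv.Perm (Fin m), Matrix.toEuclideanLin (permOp d π) ψ = ψ}
  zero_mem' := fun π => map_zero _
  add_mem' := fun ha hb π => by rw [map_add, ha π, hb π]
  smul_mem' := fun c a ha π => by rw [map_smul, ha π]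

/-- The partial trace over the last `n` of `k + n` systems. -/
def traceLast {d : Type*} [Fintype d] (k n : ℕ)
    (M : Matrix (Fin (k + n) → d) (Fin (k + n) → d) ℂ) : Matrix (Fin k → d) (Fin k → d) ℂ :=
  Matrix.of fun x y => ∑ z : Fin n → d, M (Fin.append x z) (Fin.append y z)

/-- The partial trace over the second factor of each of the `m` systems `ℂ^d ⊗ ℂ^r`. -/
def traceAncilla {d r : Type*} [Fintype r] {m : ℕ}
    (M : Matrix (Fin m → d × r) (Fin m → d × r) ℂ) : Matrix (Fin m → d) (Fin m → d) ℂ :=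
  Matrix.of fun x y => ∑ z : Fin m → r, M (fun i => (x i, z i)) (fun i => (y i, z i))

/-- The trace norm `‖X‖₁ = tr √(X† X)`. -/
def traceNorm {ι : Type*} [Fintype ι] [DecidableEq ι] (X : Matrix ι ι ℂ) : ℝ :=
  (CFC.sqrt (X.conjTranspose * X)).trace.re

/-- The trace distance `½ ‖A - B‖₁`. -/
def traceDist {ι : Type*} [Fintype ι] [DecidableEq ι] (A B : Matrix ι ι ℂ) : ℝ :=
  1 / 2 * traceNorm (A - B)

/-- Density matrices: positive semidefinite with trace one. -/
def DensityMatrix (ι : Type*) [Fintype ι] : Type _ :=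
  {ρ : Matrix ι ι ℂ // ρ.PosSemidef ∧ ρ.trace = 1}

/-- The Borel `σ`-algebra on the density matrices, generated by the matrix entries. -/
instance (ι : Type*) [Fintype ι] : MeasurableSpace (DensityMatrix ι) :=
  MeasurableSpace.comap (fun ρ => (fun i j => ρ.1 i j : ι → ι → ℂ)) inferInstance

/-- The unit vectors of `ℂ^d`. -/
abbrev UnitVectors (d : Type*) [Fintype d] : Type _ :=
  Metric.sphere (0 : EuclideanSpace ℂ d) 1

/-- Lebesgue measure on `ℂ^d`. -/
def lebesgue (d : Type*) [Fintype d] : Measure (EuclideanSpace ℂ d) :=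
  (volume : Measure (d → ℂ)).map (WithLp.toLp 2)

/-- The uniform probability measure `dφ` on the unit vectors of `ℂ^d`:
the normalized surface measure of the unit sphere. -/
def unif (d : Type*) [Fintype d] : Measure (UnitVectors d) :=
  ((lebesgue d).toSphere Set.univ)⁻¹ • (lebesgue d).toSphere

/-- The pure state `|φ⟩⟨φ|` of a unit vector `φ`, as a density matrix. -/
def pureState {d : Type*} [Fintype d] (φ : UnitVectors d) : DensityMatrix d :=
  ⟨proj φ.1, by
    have h : proj φ.1 = Matrix.vecMulVec (φ.1.ofLp) (star φ.1.ofLp) := by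
      ext i j; simp [proj, Matrix.vecMulVec_apply]
    refine ⟨h ▸ Matrix.posSemidef_vecMulVec_self_star _, ?_⟩
    have h1 : ‖φ.1‖ = 1 := by simp
    have h2 := EuclideanSpace.norm_sq_eq φ.1
    rw [h1] at h2
    simp only [Matrix.trace, Matrix.diag, proj, Matrix.of_apply, Complex.mul_conj']
    exact_mod_cast h2.symm.trans (one_pow 2)⟩

/-- The mixture `∫ dμ(σ) σ^{⊗ k}` of product states, as an entrywise integral. -/
def mixture {d : Type*} [Fintype d] (μ : Measure (DensityMatrix d)) (k : ℕ) :
    Matrix (Fin k → d) (Fin k → d) ℂ :=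
  Matrix.of fun x y => ∫ σ, matTensorPow σ.1 k x y ∂μ

/-- The vector `(I^{⊗ k} ⊗ ⟨φ|^{⊗ n}) |ψ⟩`. -/
def contract {d : Type*} [Fintype d] (k n : ℕ) (ψ : Tensors d (k + n))
    (φ : EuclideanSpace ℂ d) : Tensors d k :=
  WithLp.toLp 2 fun x => ∑ z : Fin n → d, conj (tensorPow φ n z) * ψ (Fin.append x z)

/-- The probability density, with respect to `dφ`, of the outcome `φ` when the last `n` systems of
`ψ` are measured: `p_φ = binom(D+n-1, D-1) ‖(I^{⊗ k} ⊗ ⟨φ|^{⊗ n}) |ψ⟩‖²`, where `D = |d|`. -/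
def outcomeDensity {d : Type*} [Fintype d] (k n : ℕ) (ψ : Tensors d (k + n))
    (φ : EuclideanSpace ℂ d) : ℝ :=
  ((Fintype.card d + n - 1).choose (Fintype.card d - 1) : ℝ) * ‖contract k n ψ φ‖ ^ 2

/-- The law of the pure state `|φ⟩⟨φ|` when `φ` has the density `p_φ` with respect to `dφ`. -/
def outcomeLaw {d : Type*} [Fintype d] (k n : ℕ) (ψ : Tensors d (k + n)) :
    Measure (DensityMatrix d) :=
  ((unif d).withDensity fun φ => ENNReal.ofReal (outcomeDensity k n ψ φ.1)).map pureState

/-- The average fidelity `binom(D+n-1, D-1) / binom(D+n+k-1, D-1)`. -/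
def avgFidelity (D n k : ℕ) : ℝ :=
  ((D + n - 1).choose (D - 1) : ℝ) / ((D + n + k - 1).choose (D - 1) : ℝ)

end DeFinetti

end

namespace DeFinetti

/-! Everything rests on the resolution of the identity on the symmetric subspace: `binom(D+m-1, D-1)
∫ |φ⟩⟨φ|^{⊗m} dφ` acts there as the identity (`integral_coherent_mul_conj`). It comes from explicit
moments: Gaussian integrals of monomials count permutations between words, and polar coordinates
carry the count to the sphere.

Applied to the last `n` systems, it decomposes `tr_n |ψ⟩⟨ψ|` into conditional states and gives `∫
p_φ = 1`. Applied to all `k + n` systems, it gives the average overlap with `φ^{⊗k}`, whose value is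
the ratio of the two binomials.

For the trace distance, `‖X‖₁ = tr(SX)` for a Hermitian `S` with `S² = 1`. For each `φ` the
contribution is controlled by `√(1 - fidelity)` (`re_inner_sub_le`), and concavity of the root is
used through its tangent bounds `(t/s + s)/2`, which integrate exactly.

In the mixed case, the entries of `√ρ` form a symmetric purification. The pure bound tested on `S ⊗
I` then descends through the partial trace. -/

/-! ### Permutations between words and Gaussian moments -/

open Finset in
theorem prod_comp_eq_prod_pow_card {ι d M : Type*} [Fintype ι] [Fintype d] [DecidableEq d]
    [CommMonoid M] (z : ι → d) (f : d → M) :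
    ∏ i, f (z i) = ∏ j, f j ^ Fintype.card {i // z i = j} := by
  rw [← Finset.prod_fiberwise' univ z f]
  refine prod_congr rfl fun j _ => ?_
  rw [prod_const, Fintype.card_subtype]

theorem exists_perm_comp_eq {ι d : Type*} [Fintype ι] [DecidableEq d] {z w : ι → d}
    (h : ∀ j, Fintype.card {i // z i = j} = Fintype.card {i // w i = j}) :
    ∃ σ : Equiv.Perm ι, w ∘ σ = z :=
  ⟨Equiv.ofFiberEquiv fun j => Fintype.equivOfCardEq (h j),
    funext fun i => Equiv.ofFiberEquiv_map _ i⟩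

/-- The number of permutations carrying one word to another. -/
theorem card_perm_comp_eq {ι d : Type*} [Fintype ι] [DecidableEq ι] [Fintype d] [DecidableEq d]
    (z w : ι → d) :
    Fintype.card {σ : Equiv.Perm ι // w ∘ σ = z} =
      ∏ j, if Fintype.card {i // z i = j} = Fintype.card {i // w i = j}
        then (Fintype.card {i // z i = j}).factorial else 0 := by
  by_cases h : ∀ j, Fintype.card {i // z i = j} = Fintype.card {i // w i = j}
  · obtain ⟨τ, rfl⟩ := exists_perm_comp_eq h
    rw [Finset.prod_congr rfl fun j _ => if_pos (h j), ← DomMulAct.stabilizer_card]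
    -- The solutions form a coset of the stabilizer of the word.
    refine Fintype.card_congr ((Equiv.mulLeft τ⁻¹).subtypeEquiv fun σ => ?_)
    simp [funext_iff]
  · obtain ⟨j, hj⟩ := not_forall.1 h
    rw [Finset.prod_eq_zero (Finset.mem_univ j) (if_neg hj), Fintype.card_eq_zero_iff]
    refine ⟨fun ⟨σ, hσ⟩ => hj ?_⟩
    subst hσ
    exact Fintype.card_congr (σ.subtypeEquiv fun i => Iff.rfl)

/-- For `a = b` this is a radial Gamma integral; for `a ≠ b` a rotation changes the sign of the
integral. -/
theorem integral_pow_mul_conj_pow_mul_exp (a b : ℕ) :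
    ∫ z : ℂ, z ^ a * conj z ^ b * (Real.exp (-‖z‖ ^ 2) : ℂ) =
      if a = b then (Real.pi * a.factorial : ℂ) else 0 := by
  split_ifs with h
  · subst h
    have h1 := Complex.integral_rpow_mul_exp_neg_rpow (p := 2) (q := (2 * a : ℕ)) (by norm_num)
      (by have : (0 : ℝ) ≤ (2 * a : ℕ) := Nat.cast_nonneg _
          linarith)
    have h2 : ∀ z : ℂ, z ^ a * conj z ^ a * (Real.exp (-‖z‖ ^ 2) : ℂ) =
        ((‖z‖ ^ ((2 * a : ℕ) : ℝ) * Real.exp (-‖z‖ ^ (2 : ℝ)) : ℝ) : ℂ) := by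
      intro z
      rw [← mul_pow, Complex.mul_conj', Real.rpow_natCast, Real.rpow_two, pow_mul]
      push_cast
      ring
    simp_rw [h2]
    rw [integral_complex_ofReal, h1,
      show (((2 * a : ℕ) : ℝ) + 2) / 2 = (a : ℝ) + 1 by push_cast; ring,
      Real.Gamma_nat_eq_factorial]
    push_cast
    ring
  · set I := ∫ z : ℂ, z ^ a * conj z ^ b * (Real.exp (-‖z‖ ^ 2) : ℂ) with hI
    -- Rotation by `t` multiplies the integrand by `exp(i(a - b)t)`, so this angle makes the factor
    -- `-1`.
    set t : ℝ := Real.pi / ((a : ℝ) - b) with ht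
    have hab : ((a : ℝ) - b) ≠ 0 := sub_ne_zero.2 (by exact_mod_cast h)
    have hrot : I = ∫ z : ℂ, (Circle.exp t * z) ^ a * conj (Circle.exp t * z) ^ b *
        (Real.exp (-‖(Circle.exp t : ℂ) * z‖ ^ 2) : ℂ) := by
      have := ((rotation (Circle.exp t)).measurePreserving).integral_comp
        (rotation (Circle.exp t)).toHomeomorph.measurableEmbedding
        (fun z : ℂ => z ^ a * conj z ^ b * (Real.exp (-‖z‖ ^ 2) : ℂ))
      simp only [rotation_apply] at this
      exact this.symm
    have hneg : (Circle.exp t : ℂ) ^ a * conj (Circle.exp t : ℂ) ^ b = -1 := by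
      rw [Circle.coe_exp, ← Complex.exp_conj, ← Complex.exp_nat_mul, ← Complex.exp_nat_mul,
        ← Complex.exp_add, ← Complex.exp_pi_mul_I]
      congr 1
      have : ((a : ℂ) - b) ≠ 0 := by exact_mod_cast hab
      rw [ht]
      simp
      field_simp
      ring
    have : I = -1 * I := by
      conv_lhs => rw [hrot]
      rw [hI, ← integral_const_mul, ← hneg]
      refine integral_congr_ae (.of_forall fun z => ?_)
      simp only [norm_mul, Circle.norm_coe, one_mul, map_mul]
      ring
    linear_combination this / 2

/-- Wick's formula: the integral factors over coordinates, and the one-variable factorials multiply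
to the permutation count. -/
theorem gaussian_moment {d : Type*} [Fintype d] [DecidableEq d] {m : ℕ} (z w : Fin m → d) :
    ∫ x : d → ℂ, (∏ i, x (z i)) * conj (∏ i, x (w i)) * (Real.exp (-∑ j, ‖x j‖ ^ 2) : ℂ) =
      (Real.pi : ℂ) ^ Fintype.card d * Fintype.card {σ : Equiv.Perm (Fin m) // w ∘ σ = z} := by
  have h : ∀ x : d → ℂ, (∏ i, x (z i)) * conj (∏ i, x (w i)) *
      (Real.exp (-∑ j, ‖x j‖ ^ 2) : ℂ) =
      ∏ j, (fun j (u : ℂ) => u ^ Fintype.card {i // z i = j} *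
        conj u ^ Fintype.card {i // w i = j} * (Real.exp (-‖u‖ ^ 2) : ℂ)) j (x j) := by
    intro x
    rw [prod_comp_eq_prod_pow_card, prod_comp_eq_prod_pow_card, map_prod,
      ← Finset.sum_neg_distrib, Real.exp_sum]
    push_cast
    rw [← Finset.prod_mul_distrib, ← Finset.prod_mul_distrib]
    simp
  rw [integral_congr_ae (.of_forall h), integral_fintype_prod_volume_eq_prod
    (f := fun j (u : ℂ) => u ^ Fintype.card {i // z i = j} *
        conj u ^ Fintype.card {i // w i = j} * (Real.exp (-‖u‖ ^ 2) : ℂ))]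
  simp_rw [integral_pow_mul_conj_pow_mul_exp]
  rw [card_perm_comp_eq, ← Finset.card_univ, ← Finset.prod_const, Nat.cast_prod,
    ← Finset.prod_mul_distrib]
  refine Finset.prod_congr rfl fun j _ => ?_
  split_ifs <;> simp

/-! ### Polar coordinates -/

section Polar

open Measure Set

variable {E : Type*} [NormedAddCommGroup E] [NormedSpace ℝ E] [FiniteDimensional ℝ E]
  [MeasurableSpace E] [BorelSpace E] [Nontrivial E]

theorem integral_eq_integral_toSphere_mul (μ : Measure E) [μ.IsAddHaarMeasure] {G : E → ℂ}
    {g : Metric.sphere (0 : E) 1 → ℂ} {h : ℝ → ℂ}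
    (hG : ∀ (φ : Metric.sphere (0 : E) 1) (r : ℝ), 0 < r → G (r • φ.1) = g φ * h r) :
    ∫ x, G x ∂μ = (∫ φ, g φ ∂μ.toSphere) *
      ∫ r in Ioi (0 : ℝ), (r ^ (Module.finrank ℝ E - 1) : ℝ) • h r :=
  calc
    ∫ x, G x ∂μ = ∫ x : ({(0)}ᶜ : Set E), G x.1 ∂(μ.comap (↑)) := by
      rw [integral_subtype_comap (measurableSet_singleton _).compl G, restrict_compl_singleton]
    _ = ∫ x, g x.1 * h x.2 ∂μ.toSphere.prod (.volumeIoiPow (Module.finrank ℝ E - 1)) := by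
      rw [← μ.measurePreserving_homeomorphUnitSphereProd.integral_comp
        (Homeomorph.measurableEmbedding _)]
      refine integral_congr_ae (.of_forall fun x => ?_)
      have hx : ‖x.1‖ ≠ 0 := norm_ne_zero_iff.2 x.2
      beta_reduce
      rw [← hG _ _ (homeomorphUnitSphereProd E x).2.2]
      simp [smul_smul, hx]
    _ = (∫ φ, g φ ∂μ.toSphere) *
          ∫ r : Ioi (0 : ℝ), h r ∂.volumeIoiPow (Module.finrank ℝ E - 1) :=
      integral_prod_mul g fun r : Ioi (0 : ℝ) => h r
    _ = _ := by
      congr 1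
      simp only [Measure.volumeIoiPow, ENNReal.ofReal]
      rw [integral_withDensity_eq_integral_smul,
        integral_subtype_comap measurableSet_Ioi
          fun a ↦ Real.toNNReal (a ^ (Module.finrank ℝ E - 1)) • h a,
        setIntegral_congr_fun measurableSet_Ioi fun x hx ↦ ?_]
      · rw [NNReal.smul_def, Real.coe_toNNReal _ (pow_nonneg hx.out.le _)]
      · exact (measurable_subtype_coe.pow_const _).real_toNNReal

end Polar

/-! ### Moments of the uniform measure and the resolution of the identity -/

instance (d : Type*) [Fintype d] : (lebesgue d).IsAddHaarMeasure :=
  (PiLp.continuousLinearEquiv 2 ℝ fun _ : d => ℂ).symm.isAddHaarMeasure_map volume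

theorem finrank_real_euclideanSpace (d : Type*) [Fintype d] :
    Module.finrank ℝ (EuclideanSpace ℂ d) = 2 * Fintype.card d := by
  rw [← Module.finrank_mul_finrank ℝ ℂ, Complex.finrank_real_complex, finrank_euclideanSpace]

instance (d : Type*) [Fintype d] [Nonempty d] : IsProbabilityMeasure (unif d) := by
  refine ⟨?_⟩
  rw [unif, Measure.smul_apply, smul_eq_mul, ENNReal.inv_mul_cancel]
  · exact Measure.measure_univ_ne_zero.2 (Measure.toSphere_ne_zero _)
  · exact measure_ne_top _ _

theorem integral_unif {d : Type*} [Fintype d] (f : UnitVectors d → ℂ) :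
    ∫ φ, f φ ∂unif d = ((lebesgue d).toSphere.real Set.univ : ℂ)⁻¹ *
      ∫ φ, f φ ∂(lebesgue d).toSphere := by
  rw [unif, integral_smul_measure, ENNReal.toReal_inv, Complex.real_smul, Complex.ofReal_inv]
  rfl

/-- The Gaussian moment splits into a spherical part and the radial integral of `r^(2D-1+2m)
exp(-r²)`, which is the factor `(D+m-1)!/2`. -/
theorem toSphere_moment {d : Type*} [Fintype d] [Nonempty d] [DecidableEq d] {m : ℕ}
    (z w : Fin m → d) :
    (∫ φ : UnitVectors d, tensorPow φ.1 m z * conj (tensorPow φ.1 m w) ∂(lebesgue d).toSphere) *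
        ((Fintype.card d + m - 1).factorial / 2) =
      (Real.pi : ℂ) ^ Fintype.card d * Fintype.card {σ : Equiv.Perm (Fin m) // w ∘ σ = z} := by
  have h := integral_eq_integral_toSphere_mul (lebesgue d)
    (G := fun x => tensorPow x m z * conj (tensorPow x m w) * (Real.exp (-‖x‖ ^ 2) : ℂ))
    (g := fun φ => tensorPow φ.1 m z * conj (tensorPow φ.1 m w))
    (h := fun r => ((r ^ (2 * m) * Real.exp (-r ^ 2) : ℝ) : ℂ)) (by
      intro φ r hr
      have hφ : ‖φ.1‖ = 1 := by simp
      simp only [tensorPow, PiLp.smul_apply, Complex.real_smul, Finset.prod_mul_distrib,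
        Finset.prod_const, Finset.card_univ, Fintype.card_fin, map_mul, map_pow,
        Complex.conj_ofReal, norm_smul, hφ, Real.norm_of_nonneg hr.le, mul_one]
      push_cast
      ring)
  rw [← gaussian_moment]
  have hd : 0 < Fintype.card d := Fintype.card_pos
  have hr : ∫ r in Set.Ioi (0 : ℝ), (r ^ (Module.finrank ℝ (EuclideanSpace ℂ d) - 1) : ℝ) •
      ((r ^ (2 * m) * Real.exp (-r ^ 2) : ℝ) : ℂ) =
      ((Fintype.card d + m - 1).factorial / 2 : ℂ) := by
    have h1 := integral_rpow_mul_exp_neg_rpow (p := 2)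
      (q := (2 * Fintype.card d - 1 + 2 * m : ℕ)) (by norm_num)
      (by have : (0 : ℝ) ≤ (2 * Fintype.card d - 1 + 2 * m : ℕ) := Nat.cast_nonneg _
          linarith)
    have h2 : (((2 * Fintype.card d - 1 + 2 * m : ℕ) : ℝ) + 1) / 2 =
        ((Fintype.card d + m - 1 : ℕ) : ℝ) + 1 := by
      rw [div_eq_iff two_ne_zero]
      norm_cast
      omega
    rw [h2, Real.Gamma_nat_eq_factorial] at h1
    rw [finrank_real_euclideanSpace]
    simp_rw [Complex.real_smul, ← Complex.ofReal_mul]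
    rw [integral_complex_ofReal]
    have h3 : ((Fintype.card d + m - 1).factorial / 2 : ℂ) =
      ((1 / 2 * (Fintype.card d + m - 1).factorial : ℝ) : ℂ) := by
        push_cast
        ring
    rw [h3, ← h1]
    congr 1
    refine integral_congr_ae (.of_forall fun r => ?_)
    simp only [Real.rpow_natCast, Real.rpow_two, pow_add]
    ring
  rw [hr] at h
  rw [← h, lebesgue, ← MeasurableEquiv.coe_toLp, integral_map_equiv]
  refine integral_congr_ae (.of_forall fun x => ?_)
  simp [tensorPow, EuclideanSpace.norm_sq_eq]

theorem continuous_tensorPow {d : Type*} [Fintype d] (m : ℕ) (z : Fin m → d) :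
    Continuous fun φ : UnitVectors d => tensorPow φ.1 m z := by
  simp only [tensorPow]
  fun_prop

theorem integrable_unif {d E : Type*} [Fintype d] [Nonempty d] [NormedAddCommGroup E]
    {f : UnitVectors d → E} (hf : Continuous f) : Integrable f (unif d) :=
  hf.integrable_of_hasCompactSupport (.of_compactSpace f)

theorem unif_moment {d : Type*} [Fintype d] [Nonempty d] [DecidableEq d] {m : ℕ}
    (z w : Fin m → d) :
    ∫ φ : UnitVectors d, tensorPow φ.1 m z * conj (tensorPow φ.1 m w) ∂unif d =
      (Fintype.card d - 1).factorial / (Fintype.card d + m - 1).factorial *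
        Fintype.card {σ : Equiv.Perm (Fin m) // w ∘ σ = z} := by
  have h1 := toSphere_moment z w
  -- The case `m = 0` evaluates the total surface measure; dividing by it cancels the powers of `π`.
  have h0 := toSphere_moment (d := d) (m := 0) Fin.elim0 Fin.elim0
  have hc : Fintype.card {σ : Equiv.Perm (Fin 0) // (Fin.elim0 : Fin 0 → d) ∘ σ = Fin.elim0} = 1 :=
    Fintype.card_eq_one_iff.2 ⟨⟨1, Subsingleton.elim _ _⟩, fun _ => Subsingleton.elim _ _⟩
  rw [hc] at h0
  simp only [tensorPow, Finset.univ_eq_empty, Finset.prod_empty, map_one, mul_one, add_zero,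
    integral_const, Complex.real_smul, Nat.cast_one] at h0
  rw [integral_unif]
  have hf1 : ((Fintype.card d + m - 1).factorial : ℂ) ≠ 0 := by
    exact_mod_cast Nat.factorial_ne_zero _
  have hf0 : ((Fintype.card d - 1).factorial : ℂ) ≠ 0 := by
    exact_mod_cast Nat.factorial_ne_zero _
  have hpi : (Real.pi : ℂ) ^ Fintype.card d ≠ 0 :=
    pow_ne_zero _ (by exact_mod_cast Real.pi_ne_zero)
  have hS : ((lebesgue d).toSphere.real Set.univ : ℂ) ≠ 0 := by
    rintro h
    rw [h, zero_mul] at h0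
    exact hpi h0.symm
  rw [← h0] at h1
  field_simp
  field_simp at h1
  linear_combination h1

/-- The matrix of counts is the sum of all permutation operators, so each permutation contributes
one copy of a symmetric `b`. -/
theorem sum_card_perm_comp_eq_mul {ι d : Type*} [Fintype ι] [DecidableEq ι] [Fintype d]
    [DecidableEq d] {b : (ι → d) → ℂ} (hb : ∀ (σ : Equiv.Perm ι) z, b (z ∘ σ) = b z)
    (z : ι → d) :
    ∑ w, (Fintype.card {σ : Equiv.Perm ι // z ∘ σ = w} : ℂ) * b w =
      (Fintype.card ι).factorial * b z := by
  have h : ∀ w, (Fintype.card {σ : Equiv.Perm ι // z ∘ σ = w} : ℂ) * b w =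
      ∑ σ : Equiv.Perm ι, if z ∘ σ = w then b w else 0 := by
    intro w
    rw [← Finset.sum_filter, Finset.sum_const, Fintype.card_subtype, nsmul_eq_mul]
  simp_rw [h]
  rw [Finset.sum_comm]
  simp [hb, Fintype.card_perm]

theorem choose_card_add_sub_one (D m : ℕ) (hD : 0 < D) :
    (D - 1).factorial * m.factorial * (D + m - 1).choose (D - 1) = (D + m - 1).factorial := by
  have := Nat.choose_mul_factorial_mul_factorial (n := D + m - 1) (k := D - 1) (by omega)
  rw [show D + m - 1 - (D - 1) = m by omega] at this
  rw [← this]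
  ring

/-- The resolution of the identity on the symmetric subspace, in weak form. -/
theorem integral_coherent_mul_conj {d : Type*} [Fintype d] [Nonempty d] [DecidableEq d] {m : ℕ}
    (a : (Fin m → d) → ℂ) {b : (Fin m → d) → ℂ}
    (hb : ∀ (σ : Equiv.Perm (Fin m)) z, b (z ∘ σ) = b z) :
    ((Fintype.card d + m - 1).choose (Fintype.card d - 1) : ℂ) *
      ∫ φ : UnitVectors d, (∑ z, conj (tensorPow φ.1 m z) * a z) *
        conj (∑ w, conj (tensorPow φ.1 m w) * b w) ∂unif d = ∑ z, a z * conj (b z) := by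
  have h : ∀ φ : UnitVectors d, (∑ z, conj (tensorPow φ.1 m z) * a z) *
        conj (∑ w, conj (tensorPow φ.1 m w) * b w) =
      ∑ z, ∑ w, a z * conj (b w) * (tensorPow φ.1 m w * conj (tensorPow φ.1 m z)) := by
    intro φ
    rw [map_sum, Finset.sum_mul_sum]
    refine Finset.sum_congr rfl fun z _ => Finset.sum_congr rfl fun w _ => ?_
    simp only [map_mul, Complex.conj_conj]
    ring
  have hint : ∀ z w : Fin m → d, Integrable (fun φ : UnitVectors d =>
      a z * conj (b w) * (tensorPow φ.1 m w * conj (tensorPow φ.1 m z))) (unif d) := fun z w =>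
    integrable_unif (continuous_const.mul ((continuous_tensorPow m w).mul
      (Complex.continuous_conj.comp (continuous_tensorPow m z))))
  simp_rw [h]
  rw [integral_finsetSum _ fun z _ => integrable_finsetSum _ fun w _ => hint z w]
  simp_rw [integral_finsetSum _ fun w _ => hint _ w, integral_const_mul, unif_moment]
  have hD : 0 < Fintype.card d := Fintype.card_pos
  have hch : ((Fintype.card d - 1).factorial * m.factorial *
      (Fintype.card d + m - 1).choose (Fintype.card d - 1) : ℂ) =
      (Fintype.card d + m - 1).factorial := by
    exact_mod_cast choose_card_add_sub_one _ m hD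
  have hf1 : ((Fintype.card d + m - 1).factorial : ℂ) ≠ 0 := by
    exact_mod_cast Nat.factorial_ne_zero _
  rw [Finset.mul_sum]
  refine Finset.sum_congr rfl fun z _ => ?_
  have hs := sum_card_perm_comp_eq_mul (b := fun w => conj (b w)) (fun σ z => by rw [hb]) z
  rw [Fintype.card_fin] at hs
  have : ∀ w, a z * conj (b w) * ((Fintype.card d - 1).factorial /
      (Fintype.card d + m - 1).factorial *
        Fintype.card {σ : Equiv.Perm (Fin m) // z ∘ σ = w}) =
      a z * ((Fintype.card d - 1).factorial / (Fintype.card d + m - 1).factorial) *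
        (Fintype.card {σ : Equiv.Perm (Fin m) // z ∘ σ = w} * conj (b w)) := fun w => by ring
  simp_rw [this]
  rw [← Finset.mul_sum, hs]
  field_simp
  linear_combination a z * conj (b z) * hch

/-! ### Symmetric vectors, contractions and the outcome law -/

theorem mem_symSubspace_iff {d : Type*} [Fintype d] [DecidableEq d] {m : ℕ} {ψ : Tensors d m} :
    ψ ∈ symSubspace d m ↔ ∀ (σ : Equiv.Perm (Fin m)) z, ψ (z ∘ σ) = ψ z := by
  have h : ∀ (σ : Equiv.Perm (Fin m)) z,
      Matrix.toEuclideanLin (permOp d σ) ψ z = ψ (z ∘ σ) := by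
    intro σ z
    have : ∀ x : Fin m → d, (z = fun i => x (σ⁻¹ i)) ↔ z ∘ σ = x := by
      intro x
      constructor
      · rintro rfl
        ext i
        simp
      · rintro rfl
        ext i
        simp
    simp only [Matrix.toLpLin_apply, Matrix.mulVec, dotProduct, permOp, Matrix.of_apply, this]
    simp
  constructor
  · intro hψ σ z
    rw [← h, hψ σ]
  · intro hψ σ
    ext z
    rw [h, hψ]

/-- Needed to see that each slice `z ↦ ψ (Fin.append x z)` of a symmetric vector is symmetric. -/
theorem append_comp_perm {d : Type*} {k n : ℕ} (x : Fin k → d) (z : Fin n → d)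
    (σ : Equiv.Perm (Fin n)) :
    Fin.append x (z ∘ σ) = Fin.append x z ∘
      finSumFinEquiv.permCongr (Equiv.sumCongr (Equiv.refl (Fin k)) σ) := by
  ext i
  refine Fin.addCases (fun i => ?_) (fun i => ?_) i
  · simp [Equiv.permCongr_apply]
  · simp [Equiv.permCongr_apply]

theorem tensorPow_append {d : Type*} [Fintype d] {k n : ℕ} (φ : EuclideanSpace ℂ d)
    (x : Fin k → d) (z : Fin n → d) :
    tensorPow φ (k + n) (Fin.append x z) = tensorPow φ k x * tensorPow φ n z := by
  simp [tensorPow, Fin.prod_univ_add]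

theorem sum_append {d M : Type*} [Fintype d] [AddCommMonoid M] {k n : ℕ}
    (f : (Fin (k + n) → d) → M) : ∑ y, f y = ∑ x, ∑ z, f (Fin.append x z) := by
  rw [← Fintype.sum_prod_type', ← (Fin.appendEquiv k n).sum_comp]
  rfl

theorem sum_mul_conj_self {ι : Type*} [Fintype ι] (ψ : EuclideanSpace ℂ ι) :
    ∑ y, ψ y * conj (ψ y) = ((‖ψ‖ ^ 2 : ℝ) : ℂ) := by
  rw [EuclideanSpace.norm_sq_eq]
  simp [Complex.mul_conj']

theorem continuous_contract {d : Type*} [Fintype d] {k n : ℕ} (ψ : Tensors d (k + n)) :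
    Continuous fun φ : UnitVectors d => contract k n ψ φ.1 := by
  refine (PiLp.continuous_toLp 2 _).comp (continuous_pi fun x => continuous_finsetSum _ fun z _ => ?_)
  exact (Complex.continuous_conj.comp (continuous_tensorPow n z)).mul continuous_const

theorem continuous_outcomeDensity {d : Type*} [Fintype d] {k n : ℕ} (ψ : Tensors d (k + n)) :
    Continuous fun φ : UnitVectors d => outcomeDensity k n ψ φ.1 :=
  continuous_const.mul ((continuous_contract ψ).norm.pow 2)

theorem outcomeDensity_nonneg {d : Type*} [Fintype d] {k n : ℕ} (ψ : Tensors d (k + n))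
    (φ : EuclideanSpace ℂ d) : 0 ≤ outcomeDensity k n ψ φ := by
  unfold outcomeDensity
  positivity

/-- This turns the overlap with `φ^{⊗k}` into a coherent amplitude on all `k + n` systems, where the
resolution of the identity applies again. -/
theorem inner_tensorPow_contract {d : Type*} [Fintype d] {k n : ℕ} (ψ : Tensors d (k + n))
    (φ : EuclideanSpace ℂ d) :
    inner ℂ (tensorPow φ k) (contract k n ψ φ) = ∑ y, conj (tensorPow φ (k + n) y) * ψ y := by
  rw [sum_append, PiLp.inner_apply]
  refine Finset.sum_congr rfl fun x _ => ?_
  simp only [RCLike.inner_apply, contract, Finset.sum_mul]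
  refine Finset.sum_congr rfl fun z _ => ?_
  rw [tensorPow_append, map_mul]
  ring

theorem measurable_densityMatrix_iff {α ι : Type*} [MeasurableSpace α] [Fintype ι]
    {f : α → DensityMatrix ι} : Measurable f ↔ ∀ i j, Measurable fun a => (f a).1 i j := by
  rw [measurable_comap_iff, measurable_pi_iff]
  simp_rw [measurable_pi_iff]
  rfl

theorem measurable_entry {ι : Type*} [Fintype ι] (i j : ι) :
    Measurable fun σ : DensityMatrix ι => σ.1 i j :=
  measurable_densityMatrix_iff.1 measurable_id i j

theorem measurable_pureState {d : Type*} [Fintype d] :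
    Measurable (pureState : UnitVectors d → DensityMatrix d) := by
  refine measurable_densityMatrix_iff.2 fun i j => Continuous.measurable ?_
  simp only [pureState, proj, Matrix.of_apply]
  exact ((PiLp.continuous_apply 2 _ i).comp continuous_subtype_val).mul
    (Complex.continuous_conj.comp ((PiLp.continuous_apply 2 _ j).comp continuous_subtype_val))

theorem measurable_matTensorPow {d : Type*} [Fintype d] {k : ℕ} (x y : Fin k → d) :
    Measurable fun σ : DensityMatrix d => matTensorPow σ.1 k x y := by
  simp only [matTensorPow, Matrix.of_apply]
  exact Finset.measurable_fun_prod _ fun i _ => measurable_entry (x i) (y i)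

theorem integral_outcomeLaw {d : Type*} [Fintype d] {k n : ℕ} (ψ : Tensors d (k + n))
    {g : DensityMatrix d → ℂ} (hg : Measurable g) :
    ∫ σ, g σ ∂outcomeLaw k n ψ = ∫ φ : UnitVectors d,
      (outcomeDensity k n ψ φ.1 : ℂ) * g (pureState φ) ∂unif d := by
  rw [outcomeLaw, integral_map measurable_pureState.aemeasurable hg.aestronglyMeasurable,
    integral_withDensity_eq_integral_toReal_smul
      (continuous_outcomeDensity ψ).measurable.ennreal_ofReal (.of_forall fun _ => by simp)]
  refine integral_congr_ae (.of_forall fun φ => ?_)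
  beta_reduce
  rw [ENNReal.toReal_ofReal (outcomeDensity_nonneg ψ _), Complex.real_smul]

theorem matTensorPow_pureState {d : Type*} [Fintype d] (φ : UnitVectors d) (k : ℕ) :
    matTensorPow (pureState φ).1 k = proj (tensorPow φ.1 k) := by
  ext x y
  simp [matTensorPow, pureState, proj, tensorPow, Finset.prod_mul_distrib]

theorem mixture_outcomeLaw {d : Type*} [Fintype d] {k n : ℕ} (ψ : Tensors d (k + n))
    (x y : Fin k → d) :
    mixture (outcomeLaw k n ψ) k x y = ∫ φ : UnitVectors d,
      (outcomeDensity k n ψ φ.1 : ℂ) * proj (tensorPow φ.1 k) x y ∂unif d := by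
  rw [mixture, Matrix.of_apply, integral_outcomeLaw ψ (measurable_matTensorPow x y)]
  simp_rw [matTensorPow_pureState]

/-! ### Exact averages over the measurement outcome -/

section Symmetric

variable {d : Type*} [Fintype d] [Nonempty d] [DecidableEq d] {k n : ℕ} {ψ : Tensors d (k + n)}

theorem integral_contract_mul_conj (hψ : ψ ∈ symSubspace d (k + n)) (x y : Fin k → d) :
    ((Fintype.card d + n - 1).choose (Fintype.card d - 1) : ℂ) *
      ∫ φ : UnitVectors d, contract k n ψ φ.1 x * conj (contract k n ψ φ.1 y) ∂unif d =
      traceLast k n (proj ψ) x y := by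
  refine integral_coherent_mul_conj (fun z => ψ (Fin.append x z))
    (b := fun z => ψ (Fin.append y z)) fun σ z => ?_
  rw [append_comp_perm, mem_symSubspace_iff.1 hψ]

theorem integral_outcomeDensity (hψ : ψ ∈ symSubspace d (k + n)) (h1 : ‖ψ‖ = 1) :
    ∫ φ : UnitVectors d, outcomeDensity k n ψ φ.1 ∂unif d = 1 := by
  have hc : ∀ x, Continuous fun φ : UnitVectors d => contract k n ψ φ.1 x := fun x =>
    (PiLp.continuous_apply 2 _ x).comp (continuous_contract ψ)
  have h : ∀ φ : UnitVectors d, ((outcomeDensity k n ψ φ.1 : ℝ) : ℂ) =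
      ((Fintype.card d + n - 1).choose (Fintype.card d - 1) : ℂ) *
        ∑ x, contract k n ψ φ.1 x * conj (contract k n ψ φ.1 x) := by
    intro φ
    rw [sum_mul_conj_self, outcomeDensity]
    push_cast
    rfl
  rw [← Complex.ofReal_inj, ← integral_complex_ofReal]
  simp_rw [h]
  rw [integral_const_mul, integral_finsetSum, Finset.mul_sum]
  · simp_rw [integral_contract_mul_conj hψ]
    simp only [traceLast, proj, Matrix.of_apply]
    rw [← sum_append fun y => ψ y * conj (ψ y), sum_mul_conj_self, h1]
    simp
  · exact fun x _ => integrable_unif ((hc x).mul (Complex.continuous_conj.comp (hc x)))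

/-- The resolution on `k + n` systems makes the integral the inverse of its own binomial, while the
prefactor is the binomial for `n` systems. -/
theorem integral_norm_inner_sq (hψ : ψ ∈ symSubspace d (k + n)) (h1 : ‖ψ‖ = 1) :
    ((Fintype.card d + n - 1).choose (Fintype.card d - 1) : ℝ) *
      ∫ φ : UnitVectors d, ‖inner ℂ (contract k n ψ φ.1) (tensorPow φ.1 k)‖ ^ 2 ∂unif d =
      avgFidelity (Fintype.card d) n k := by
  have hD : 0 < Fintype.card d := Fintype.card_pos
  have h := integral_coherent_mul_conj (fun z => ψ z) (b := fun z => ψ z) (mem_symSubspace_iff.1 hψ)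
  have hc : ∀ φ : UnitVectors d, (∑ z, conj (tensorPow φ.1 (k + n) z) * ψ z) *
      conj (∑ z, conj (tensorPow φ.1 (k + n) z) * ψ z) =
      ((‖inner ℂ (contract k n ψ φ.1) (tensorPow φ.1 k)‖ ^ 2 : ℝ) : ℂ) := by
    intro φ
    rw [← inner_tensorPow_contract, Complex.mul_conj', norm_inner_symm, Complex.ofReal_pow]
  simp_rw [hc] at h
  rw [integral_complex_ofReal, sum_mul_conj_self, h1] at h
  have h' : ((Fintype.card d + (k + n) - 1).choose (Fintype.card d - 1) : ℝ) *
      ∫ φ : UnitVectors d, ‖inner ℂ (contract k n ψ φ.1) (tensorPow φ.1 k)‖ ^ 2 ∂unif d = 1 := by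
    rw [← Complex.ofReal_inj]
    push_cast at h ⊢
    rw [h]
    simp
  have h0 : ((Fintype.card d + (k + n) - 1).choose (Fintype.card d - 1) : ℝ) ≠ 0 := by
    have := Nat.choose_pos (n := Fintype.card d + (k + n) - 1) (k := Fintype.card d - 1) (by omega)
    exact_mod_cast this.ne'
  rw [avgFidelity, show Fintype.card d + n + k - 1 = Fintype.card d + (k + n) - 1 by omega,
    eq_div_iff h0, mul_assoc, mul_comm (∫ _, _ ∂_), h', mul_one]

theorem isProbabilityMeasure_outcomeLaw (hψ : ψ ∈ symSubspace d (k + n)) (h1 : ‖ψ‖ = 1) :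
    IsProbabilityMeasure (outcomeLaw k n ψ) := by
  have : IsProbabilityMeasure
      ((unif d).withDensity fun φ => ENNReal.ofReal (outcomeDensity k n ψ φ.1)) := by
    refine ⟨?_⟩
    rw [withDensity_apply _ .univ, Measure.restrict_univ, ← ofReal_integral_eq_lintegral_ofReal
      (integrable_unif (continuous_outcomeDensity ψ))
      (.of_forall fun φ => outcomeDensity_nonneg ψ _), integral_outcomeDensity hψ h1,
      ENNReal.ofReal_one]
  exact Measure.isProbabilityMeasure_map measurable_pureState.aemeasurable

end Symmetric

/-- A measurable choice of the normalized conditional states. -/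
theorem exists_measurable_normalized {d : Type*} [Fintype d]
    [Nonempty d] {k n : ℕ} (ψ : Tensors d (k + n)) :
    ∃ v : UnitVectors d → Tensors d k, Measurable v ∧ (∀ φ, ‖v φ‖ = 1) ∧
      ∀ φ, (Real.sqrt ((Fintype.card d + n - 1).choose (Fintype.card d - 1)) : ℂ) •
          contract k n ψ φ.1 = (Real.sqrt (outcomeDensity k n ψ φ.1) : ℂ) • v φ := by
  classical
  -- Where the contraction vanishes the density is zero, so any fixed unit vector serves.
  refine ⟨fun φ => if contract k n ψ φ.1 = 0 then
      EuclideanSpace.single (fun _ => Classical.arbitrary d) 1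
    else ((‖contract k n ψ φ.1‖⁻¹ : ℝ) : ℂ) • contract k n ψ φ.1, ?_, fun φ => ?_, fun φ => ?_⟩
  · have hc := (continuous_contract ψ).measurable
    exact Measurable.ite (hc (measurableSet_singleton 0)) measurable_const
      ((Complex.measurable_ofReal.comp hc.norm.inv).smul hc)
  · beta_reduce
    split_ifs with h
    · simp
    · simp [norm_smul, h]
  · beta_reduce
    split_ifs with h
    · simp [outcomeDensity, h]
    · have h0 : (‖contract k n ψ φ.1‖ : ℂ) ≠ 0 := by simpa using h
      rw [outcomeDensity, Real.sqrt_mul (Nat.cast_nonneg _), Real.sqrt_sq (norm_nonneg _),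
        smul_smul]
      congr 1
      push_cast
      field_simp

/-! ### Lower bound on the average fidelity -/

theorem avgFidelity_le_one (D n k : ℕ) : avgFidelity D n k ≤ 1 := by
  refine div_le_one_of_le₀ ?_ (Nat.cast_nonneg _)
  exact_mod_cast Nat.choose_le_choose _ (by omega)

theorem avgFidelity_succ (E n k : ℕ) :
    avgFidelity (E + 1) n (k + 1) = avgFidelity (E + 1) n k * (1 - E / (E + n + k + 1)) := by
  have h := Nat.choose_mul_succ_eq (E + n + k) E
  rw [show E + n + k + 1 - E = n + k + 1 by omega] at h
  have h1 : ((E + n + k).choose E : ℝ) ≠ 0 := by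
    exact_mod_cast (Nat.choose_pos (by omega)).ne'
  have h2 : ((E + n + k + 1).choose E : ℝ) ≠ 0 := by
    exact_mod_cast (Nat.choose_pos (by omega)).ne'
  have h3 : (E + n + k + 1 : ℝ) ≠ 0 := by positivity
  have h' : ((E + n + k).choose E : ℝ) * (E + n + k + 1) =
      (E + n + k + 1).choose E * (n + k + 1) := by exact_mod_cast h
  simp only [avgFidelity, Nat.add_sub_cancel, show E + 1 + n - 1 = E + n by omega,
    show E + 1 + n + (k + 1) - 1 = E + n + k + 1 by omega,
    show E + 1 + n + k - 1 = E + n + k by omega]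
  field_simp
  linear_combination ((E + n).choose E : ℝ) * h'

/-- Induction on `k`: raising `k` by one multiplies a number at most `1` by a factor at least `1 -
D/n`, so at most `D/n` is lost. -/
theorem one_sub_le_avgFidelity (D n k : ℕ) (hn : 0 < n) :
    1 - (k : ℝ) * D / n ≤ avgFidelity D n k := by
  obtain _ | E := D
  -- For `D = 0`, truncated subtraction makes both binomials `choose _ 0 = 1`.
  · simp [avgFidelity]
  induction k with
  | zero =>
    have : (((E + 1 + n - 1).choose (E + 1 - 1) : ℕ) : ℝ) ≠ 0 := by
      exact_mod_cast (Nat.choose_pos (by omega)).ne'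
    simp only [avgFidelity, Nat.add_zero, div_self this]
    simp
  | succ k ih =>
    have hn' : (0 : ℝ) < n := by exact_mod_cast hn
    have h1 : (E : ℝ) / (E + n + k + 1) ≤ ((E + 1 : ℕ) : ℝ) / n := by
      gcongr
      · simp
      · have : (0 : ℝ) ≤ (E : ℝ) + k + 1 := by positivity
        linarith
    have h2 : avgFidelity (E + 1) n k * (E / (E + n + k + 1)) ≤ E / (E + n + k + 1) :=
      mul_le_of_le_one_left (by positivity) (avgFidelity_le_one _ _ _)
    rw [avgFidelity_succ, Nat.cast_succ, add_mul, add_div, one_mul, mul_sub, mul_one]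
    linarith

/-! ### Trace norm and the fidelity inequality -/

section TraceNorm

variable {ι : Type*} [Fintype ι] [DecidableEq ι]

/-- Take the sign of `X` by functional calculus, with value `1` at `0` so that the square is the
identity; then `S * X = |X|`. -/
theorem exists_sign_matrix {X : Matrix ι ι ℂ} (hX : X.IsHermitian) :
    ∃ S : Matrix ι ι ℂ, S.IsHermitian ∧ S * S = 1 ∧ traceNorm X = (S * X).trace.re := by
  have hX' : IsSelfAdjoint X := hX
  have hcont : ∀ f : ℝ → ℝ, ContinuousOn f (spectrum ℝ X) := fun f =>
    (Matrix.finite_real_spectrum (A := X)).continuousOn f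
  have hS2 : cfc (fun x : ℝ => if 0 ≤ x then (1 : ℝ) else -1) X *
      cfc (fun x : ℝ => if 0 ≤ x then (1 : ℝ) else -1) X = 1 := by
    rw [← cfc_mul _ _ X (hcont _) (hcont _), ← cfc_one ℝ X]
    congr 1
    ext x
    split_ifs <;> simp
  have hSX : cfc (fun x : ℝ => if 0 ≤ x then (1 : ℝ) else -1) X * X = cfc (fun x : ℝ => |x|) X := by
    rw [show (fun x : ℝ => |x|) = fun x => (if 0 ≤ x then (1 : ℝ) else -1) * x from ?_,
      cfc_mul _ _ X (hcont _) (hcont _), cfc_id' ℝ X]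
    ext x
    split_ifs with h
    · rw [abs_of_nonneg h, one_mul]
    · rw [abs_of_neg (not_le.1 h), neg_one_mul]
  have habs : cfc (fun x : ℝ => |x|) X * cfc (fun x : ℝ => |x|) X = X.conjTranspose * X := by
    rw [← cfc_mul _ _ X (hcont _) (hcont _), hX.eq]
    have h : cfc (fun x : ℝ => x * x) X = X * X := by
      rw [cfc_mul _ _ X (hcont _) (hcont _), cfc_id' ℝ X]
    simp_rw [abs_mul_abs_self, h]
  refine ⟨cfc (fun x : ℝ => if 0 ≤ x then (1 : ℝ) else -1) X, cfc_predicate _ X, hS2, ?_⟩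
  rw [hSX, traceNorm, CFC.sqrt_unique habs (cfc_nonneg fun x _ => abs_nonneg x)]

end TraceNorm

/-- Adjust the phase of `f` to a vector `g` whose overlap with `v` is a real `c ≥ 0`. The difference
is then `Re ⟨v + g, T (v - g)⟩`, and Cauchy–Schwarz with `‖v ± g‖² = 2 ± 2c` finishes. -/
theorem re_inner_sub_le {H : Type*} [NormedAddCommGroup H] [InnerProductSpace ℂ H]
    {T : H →ₗ[ℂ] H} (hT : T.IsSymmetric) (hT1 : ∀ x, ‖T x‖ ≤ ‖x‖) {v f : H} (hv : ‖v‖ = 1)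
    (hf : ‖f‖ = 1) :
    (inner ℂ v (T v)).re - (inner ℂ f (T f)).re ≤ 2 * Real.sqrt (1 - ‖inner ℂ v f‖ ^ 2) := by
  obtain ⟨u, hu, huc⟩ : ∃ u : ℂ, ‖u‖ = 1 ∧ u * inner ℂ v f = (‖inner ℂ v f‖ : ℂ) := by
    by_cases h : inner ℂ v f = 0
    · exact ⟨1, by simp, by simp [h]⟩
    · refine ⟨conj (inner ℂ v f) / ‖inner ℂ v f‖, ?_, ?_⟩
      · rw [norm_div, RCLike.norm_conj, Complex.norm_real, norm_norm,
          div_self (norm_ne_zero_iff.2 h)]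
      have : (‖inner ℂ v f‖ : ℂ) ≠ 0 := by simpa using h
      field_simp
      exact Complex.conj_mul' _
  set c := ‖inner ℂ v f‖
  set g := u • f with hg
  have hgn : ‖g‖ = 1 := by rw [hg, norm_smul, hu, hf, one_mul]
  have hvg : inner ℂ v g = (c : ℂ) := by rw [hg, inner_smul_right, huc]
  have hgg : inner ℂ g (T g) = inner ℂ f (T f) := by
    rw [hg, map_smul, inner_smul_left, inner_smul_right, ← mul_assoc, Complex.conj_mul', hu]
    simp
  have h1 : (inner ℂ (v + g) (T (v - g))).re = (inner ℂ v (T v)).re - (inner ℂ f (T f)).re := by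
    have hre : (inner ℂ (T v) g).re = (inner ℂ g (T v)).re := by
      rw [← inner_conj_symm, Complex.conj_re]
    rw [map_sub, inner_sub_right, inner_add_left, inner_add_left, hgg, ← hT v g]
    simp only [Complex.add_re, Complex.sub_re, hre]
    ring
  have h2 : (inner ℂ (v + g) (T (v - g))).re ≤ ‖v + g‖ * ‖v - g‖ :=
    (Complex.re_le_norm _).trans ((norm_inner_le_norm _ _).trans
      (mul_le_mul_of_nonneg_left (hT1 _) (norm_nonneg _)))
  have hp : ‖v + g‖ ^ 2 = 2 + 2 * c := by
    rw [norm_add_sq (𝕜 := ℂ), hv, hgn, hvg]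
    simp
    ring
  have hm : ‖v - g‖ ^ 2 = 2 - 2 * c := by
    rw [norm_sub_sq (𝕜 := ℂ), hv, hgn, hvg]
    simp
    ring
  rw [← h1]
  refine h2.trans (le_of_eq ?_)
  rw [← Real.sqrt_sq (by positivity : 0 ≤ ‖v + g‖ * ‖v - g‖), mul_pow, hp, hm,
    show (2 + 2 * c) * (2 - 2 * c) = 2 ^ 2 * (1 - c ^ 2) by ring,
    Real.sqrt_mul (by positivity), Real.sqrt_sq zero_le_two]

theorem sqrt_le_div_add {t s : ℝ} (ht : 0 ≤ t) (hs : 0 < s) : Real.sqrt t ≤ (t / s + s) / 2 := by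
  have h : 0 ≤ (Real.sqrt t - s) ^ 2 := sq_nonneg _
  rw [sub_sq, Real.sq_sqrt ht] at h
  rw [div_add' _ _ _ hs.ne', div_div, le_div_iff₀ (by positivity)]
  linarith

/-- The root is the infimum of these bounds, attained at `s = √t` when `t > 0` and only approached
as `s → 0` when `t = 0`. -/
theorem le_sqrt_of_forall_le_div_add {a t : ℝ} (ht : 0 ≤ t)
    (h : ∀ s, 0 < s → a ≤ (t / s + s) / 2) : a ≤ Real.sqrt t := by
  rcases ht.eq_or_lt with rfl | ht
  · rw [Real.sqrt_zero]
    refine le_of_forall_pos_le_add fun ε hε => ?_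
    have := h ε hε
    simp at this
    linarith
  · have := h _ (Real.sqrt_pos.2 ht)
    rwa [Real.div_sqrt, add_self_div_two] at this

/-- Scaling by `‖w‖²` lets the bound apply to the unnormalized contraction, which is continuous in
`φ` and may vanish. -/
theorem re_inner_sub_norm_sq_mul_le {H : Type*} [NormedAddCommGroup H] [InnerProductSpace ℂ H]
    {T : H →ₗ[ℂ] H} (hT : T.IsSymmetric) (hT1 : ∀ x, ‖T x‖ ≤ ‖x‖) (w : H) {f : H}
    (hf : ‖f‖ = 1) {s : ℝ} (hs : 0 < s) :
    1 / 2 * ((inner ℂ w (T w)).re - ‖w‖ ^ 2 * (inner ℂ f (T f)).re) ≤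
      ((‖w‖ ^ 2 - ‖inner ℂ w f‖ ^ 2) / s + s * ‖w‖ ^ 2) / 2 := by
  by_cases hw : w = 0
  · simp [hw]
  have hw0 : ‖w‖ ≠ 0 := norm_ne_zero_iff.2 hw
  set v : H := ((‖w‖⁻¹ : ℝ) : ℂ) • w with hv
  have hv1 : ‖v‖ = 1 := by simp [hv, norm_smul, hw0]
  have hwv : w = (‖w‖ : ℂ) • v := by
    rw [hv, smul_smul, ← Complex.ofReal_mul, mul_inv_cancel₀ hw0]
    simp
  have h1 : (inner ℂ w (T w)).re = ‖w‖ ^ 2 * (inner ℂ v (T v)).re := by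
    conv_lhs => rw [hwv, map_smul, inner_smul_left, inner_smul_right, Complex.conj_ofReal,
      Complex.re_ofReal_mul, Complex.re_ofReal_mul]
    ring
  have h2 : ‖inner ℂ w f‖ ^ 2 = ‖w‖ ^ 2 * ‖inner ℂ v f‖ ^ 2 := by
    conv_lhs => rw [hwv, inner_smul_left, norm_mul, mul_pow]
    simp
  have h3 : ‖inner ℂ v f‖ ≤ 1 := by simpa [hv1, hf] using norm_inner_le_norm (𝕜 := ℂ) v f
  have h4 : 0 ≤ 1 - ‖inner ℂ v f‖ ^ 2 := by
    have := pow_le_one₀ (n := 2) (norm_nonneg _) h3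
    linarith
  have h5 := (re_inner_sub_le hT hT1 hv1 hf).trans
    (mul_le_mul_of_nonneg_left (sqrt_le_div_add h4 hs) zero_le_two)
  have h6 := mul_le_mul_of_nonneg_left h5 (sq_nonneg ‖w‖)
  rw [h1, h2]
  calc _ = 1 / 2 * (‖w‖ ^ 2 * ((inner ℂ v (T v)).re - (inner ℂ f (T f)).re)) := by ring
    _ ≤ 1 / 2 * (‖w‖ ^ 2 * (2 * (((1 - ‖inner ℂ v f‖ ^ 2) / s + s) / 2))) :=
      mul_le_mul_of_nonneg_left h6 (by norm_num)
    _ = _ := by ring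

section

variable {ι : Type*} [Fintype ι] [DecidableEq ι]

theorem trace_mul_proj (S : Matrix ι ι ℂ) (w : EuclideanSpace ℂ ι) :
    (S * proj w).trace = inner ℂ w (Matrix.toEuclideanLin S w) := by
  simp only [Matrix.trace, Matrix.diag, Matrix.mul_apply, proj, Matrix.of_apply, PiLp.inner_apply,
    RCLike.inner_apply, Matrix.toLpLin_apply, Matrix.mulVec, dotProduct, Finset.sum_mul]
  exact Finset.sum_congr rfl fun x _ => Finset.sum_congr rfl fun y _ => by ring

theorem isSymmetric_and_norm_toEuclideanLin {S : Matrix ι ι ℂ} (hS : S.IsHermitian)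
    (hS2 : S * S = 1) : (Matrix.toEuclideanLin S).IsSymmetric ∧
      ∀ x, ‖Matrix.toEuclideanLin S x‖ ≤ ‖x‖ := by
  have hsym : (Matrix.toEuclideanLin S).IsSymmetric := Matrix.isSymmetric_toEuclideanLin_iff.2 hS
  refine ⟨hsym, fun x => le_of_eq ?_⟩
  have h : Matrix.toEuclideanLin S (Matrix.toEuclideanLin S x) = x := by
    simp [Matrix.toLpLin_apply, hS2]
  rw [← sq_eq_sq₀ (norm_nonneg _) (norm_nonneg _), ← inner_self_eq_norm_sq (𝕜 := ℂ),
    hsym, h, inner_self_eq_norm_sq]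

end

theorem norm_tensorPow {d : Type*} [Fintype d] (φ : UnitVectors d) (m : ℕ) : ‖tensorPow φ.1 m‖ = 1 := by
  have h : ∑ j, ‖φ.1 j‖ ^ 2 = 1 := by
    rw [← EuclideanSpace.norm_sq_eq]
    simp
  rw [← sq_eq_sq₀ (norm_nonneg _) zero_le_one, EuclideanSpace.norm_sq_eq, one_pow]
  simp only [tensorPow, norm_prod, ← Finset.prod_pow]
  rw [← Fintype.piFinset_univ, ← Finset.prod_univ_sum (fun _ => Finset.univ) fun _ j => ‖φ.1 j‖ ^ 2]
  simp [h]

theorem continuous_tensorPow_vec {d : Type*} [Fintype d] (m : ℕ) :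
    Continuous fun φ : UnitVectors d => tensorPow φ.1 m :=
  (PiLp.continuous_toLp 2 _).comp (continuous_pi fun z => continuous_tensorPow m z)

theorem continuous_proj {ι α : Type*} [Fintype ι] [TopologicalSpace α] {f : α → EuclideanSpace ℂ ι}
    (hf : Continuous f) (x y : ι) : Continuous fun a => proj (f a) x y :=
  ((PiLp.continuous_apply 2 _ x).comp hf).mul
    (Complex.continuous_conj.comp ((PiLp.continuous_apply 2 _ y).comp hf))

theorem isHermitian_traceLast_proj {d : Type*} [Fintype d] {k n : ℕ} (ψ : Tensors d (k + n)) :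
    (traceLast k n (proj ψ)).IsHermitian := by
  ext x y
  simp [traceLast, proj, mul_comm]

theorem isHermitian_mixture {d : Type*} [Fintype d] (μ : Measure (DensityMatrix d)) (k : ℕ) :
    (mixture μ k).IsHermitian := by
  ext x y
  rw [Matrix.conjTranspose_apply, mixture, Matrix.of_apply, Matrix.of_apply]
  rw [← starRingEnd_apply, ← integral_conj]
  refine integral_congr_ae (.of_forall fun σ => ?_)
  simp only [matTensorPow, Matrix.of_apply, map_prod]
  exact Finset.prod_congr rfl fun i _ => σ.2.1.isHermitian.apply _ _

/-! ### Trace distance for symmetric pure states -/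

section Bound

variable {d : Type*} [Fintype d] [Nonempty d] [DecidableEq d] {k n : ℕ} {ψ : Tensors d (k + n)}

/-- Stated for every reflection `S`, not only the optimal one, so that the mixed case can use it
with `S ⊗ I`. -/
theorem re_trace_mul_sub_le (hψ : ψ ∈ symSubspace d (k + n)) (h1 : ‖ψ‖ = 1)
    {S : Matrix (Fin k → d) (Fin k → d) ℂ} (hS : S.IsHermitian) (hS2 : S * S = 1) :
    1 / 2 * (S * (traceLast k n (proj ψ) - mixture (outcomeLaw k n ψ) k)).trace.re ≤
      Real.sqrt (1 - avgFidelity (Fintype.card d) n k) := by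
  obtain ⟨hT, hT1⟩ := isSymmetric_and_norm_toEuclideanLin hS hS2
  set T := Matrix.toEuclideanLin S with hTdef
  set C : ℝ := ((Fintype.card d + n - 1).choose (Fintype.card d - 1) : ℝ) with hC
  have hC0 : 0 ≤ C := Nat.cast_nonneg _
  have hcc := continuous_contract ψ
  have hct := continuous_tensorPow_vec (d := d) k
  have hcp : Continuous fun φ : UnitVectors d => (outcomeDensity k n ψ φ.1 : ℂ) :=
    Complex.continuous_ofReal.comp (continuous_outcomeDensity ψ)
  have hent : ∀ x y, (traceLast k n (proj ψ) - mixture (outcomeLaw k n ψ) k) x y =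
      ∫ φ : UnitVectors d, ((C : ℂ) * proj (contract k n ψ φ.1) x y -
        (outcomeDensity k n ψ φ.1 : ℂ) * proj (tensorPow φ.1 k) x y) ∂unif d := by
    intro x y
    rw [integral_sub, Matrix.sub_apply, mixture_outcomeLaw, ← integral_contract_mul_conj hψ,
      ← integral_const_mul]
    · simp [proj, hC]
    · exact integrable_unif (continuous_const.mul (continuous_proj hcc x y))
    · exact integrable_unif (hcp.mul (continuous_proj hct x y))
  have hcq : ∀ x y, Continuous fun φ : UnitVectors d => (C : ℂ) * proj (contract k n ψ φ.1) x y -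
        (outcomeDensity k n ψ φ.1 : ℂ) * proj (tensorPow φ.1 k) x y := fun x y =>
    (continuous_const.mul (continuous_proj hcc x y)).sub (hcp.mul (continuous_proj hct x y))
  have htr : (S * (traceLast k n (proj ψ) - mixture (outcomeLaw k n ψ) k)).trace =
      ∫ φ : UnitVectors d, ((C : ℂ) * inner ℂ (contract k n ψ φ.1) (T (contract k n ψ φ.1)) -
        (outcomeDensity k n ψ φ.1 : ℂ) * inner ℂ (tensorPow φ.1 k) (T (tensorPow φ.1 k)))
        ∂unif d := by
    simp_rw [hTdef, ← trace_mul_proj, Matrix.trace, Matrix.diag, Matrix.mul_apply, hent,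
      ← integral_const_mul]
    have hi : ∀ x y, Integrable (fun φ : UnitVectors d => S x y *
        ((C : ℂ) * proj (contract k n ψ φ.1) y x -
          (outcomeDensity k n ψ φ.1 : ℂ) * proj (tensorPow φ.1 k) y x)) (unif d) := fun x y =>
      integrable_unif (continuous_const.mul (hcq y x))
    simp_rw [← integral_finsetSum _ fun y _ => hi _ y]
    rw [← integral_finsetSum _ fun x _ => integrable_finsetSum _ fun y _ => hi x y]
    refine integral_congr_ae (.of_forall fun φ => ?_)
    beta_reduce
    simp_rw [Finset.mul_sum, ← Finset.sum_sub_distrib]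
    exact Finset.sum_congr rfl fun x _ => Finset.sum_congr rfl fun y _ => by ring
  have hTc : Continuous T := T.continuous_of_finiteDimensional
  have hcQ : Continuous fun φ : UnitVectors d =>
      (C : ℂ) * inner ℂ (contract k n ψ φ.1) (T (contract k n ψ φ.1)) -
        (outcomeDensity k n ψ φ.1 : ℂ) * inner ℂ (tensorPow φ.1 k) (T (tensorPow φ.1 k)) :=
    (continuous_const.mul (hcc.inner (hTc.comp hcc))).sub (hcp.mul (hct.inner (hTc.comp hct)))
  have hF1 := avgFidelity_le_one (Fintype.card d) n k
  -- With `s` fixed before integrating, the pointwise bound is linear in the density and the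
  -- weighted fidelity, whose integrals are known; this replaces Jensen.
  refine le_sqrt_of_forall_le_div_add (by linarith) fun s hs => ?_
  have hcF : Continuous fun φ : UnitVectors d =>
      C * ‖inner ℂ (contract k n ψ φ.1) (tensorPow φ.1 k)‖ ^ 2 :=
    continuous_const.mul ((hcc.inner hct).norm.pow 2)
  have hRHS : ((1 - avgFidelity (Fintype.card d) n k) / s + s) / 2 = ∫ φ : UnitVectors d,
      ((outcomeDensity k n ψ φ.1 - C * ‖inner ℂ (contract k n ψ φ.1) (tensorPow φ.1 k)‖ ^ 2) / s +
        s * outcomeDensity k n ψ φ.1) / 2 ∂unif d := by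
    have hp := integrable_unif (continuous_outcomeDensity ψ)
    have hq : Integrable (fun φ : UnitVectors d => (outcomeDensity k n ψ φ.1 -
        C * ‖inner ℂ (contract k n ψ φ.1) (tensorPow φ.1 k)‖ ^ 2) / s) (unif d) :=
      (hp.sub (integrable_unif hcF)).div_const s
    rw [integral_div, integral_add hq (hp.const_mul s),
      integral_div, integral_sub hp (integrable_unif hcF), integral_const_mul, integral_const_mul,
      integral_outcomeDensity hψ h1, integral_norm_inner_sq hψ h1, mul_one]
  rw [htr, hRHS, ← Complex.reCLM_apply,
    ← ContinuousLinearMap.integral_comp_comm _ (integrable_unif hcQ), ← integral_const_mul]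
  refine integral_mono (integrable_unif (continuous_const.mul (Complex.continuous_re.comp hcQ)))
    (integrable_unif (by have := continuous_outcomeDensity ψ; fun_prop)) fun φ => ?_
  have h := mul_le_mul_of_nonneg_left
    (re_inner_sub_norm_sq_mul_le hT hT1 (contract k n ψ φ.1) (norm_tensorPow φ k) hs) hC0
  simp only [Complex.reCLM_apply, Complex.sub_re, Complex.re_ofReal_mul, outcomeDensity, ← hC]
  calc _ = _ := ?_
    _ ≤ _ := h
    _ = _ := ?_
  · ring
  · ring

theorem traceDist_traceLast_proj_le (hψ : ψ ∈ symSubspace d (k + n)) (h1 : ‖ψ‖ = 1) :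
    traceDist (traceLast k n (proj ψ)) (mixture (outcomeLaw k n ψ) k) ≤
      Real.sqrt (1 - avgFidelity (Fintype.card d) n k) := by
  obtain ⟨S, hS, hS2, h⟩ :=
    exists_sign_matrix ((isHermitian_traceLast_proj ψ).sub (isHermitian_mixture _ k))
  rw [traceDist, h]
  exact re_trace_mul_sub_le hψ h1 hS hS2

end Bound

/-! ### Symmetric purification -/

theorem permOp_mul_mul_conjTranspose {d : Type*} [Fintype d] [DecidableEq d] {m : ℕ}
    (π : Equiv.Perm (Fin m)) (M : Matrix (Fin m → d) (Fin m → d) ℂ) :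
    permOp d π * M * (permOp d π).conjTranspose =
      M.submatrix (π.symm.arrowCongr (.refl d)) (π.symm.arrowCongr (.refl d)) := by
  have h : ∀ z x : Fin m → d, (z = fun i => x (π⁻¹ i)) ↔ z ∘ π = x := by
    intro z x
    constructor
    · rintro rfl
      ext i
      simp
    · rintro rfl
      ext i
      simp
  ext x y
  simp only [Matrix.mul_apply, permOp, Matrix.of_apply, Matrix.conjTranspose_apply, h]
  simp [Equiv.arrowCongr, Function.comp_def]

theorem sum_pairs {ι d r M : Type*} [Fintype ι] [DecidableEq ι] [Fintype d] [Fintype r]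
    [AddCommMonoid M] (f : (ι → d × r) → M) :
    ∑ p, f p = ∑ x : ι → d, ∑ z : ι → r, f fun i => (x i, z i) := by
  rw [← Fintype.sum_prod_type', ← (Equiv.arrowProdEquivProdArrow ι _ _).symm.sum_comp]
  rfl

theorem trace_traceAncilla {d r : Type*} [Fintype d] [Fintype r] {m : ℕ}
    (M : Matrix (Fin m → d × r) (Fin m → d × r) ℂ) : (traceAncilla M).trace = M.trace := by
  simp only [Matrix.trace, Matrix.diag]
  rw [sum_pairs]
  rfl

theorem trace_proj {ι : Type*} [Fintype ι] (w : EuclideanSpace ℂ ι) :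
    (proj w).trace = ((‖w‖ ^ 2 : ℝ) : ℂ) :=
  sum_mul_conj_self w

/-- The amplitudes are the entries of `√ρ`. Conjugating `√ρ` by a permutation gives another positive
root of `ρ`, hence `√ρ` itself, and this invariance is the symmetry of the vector. -/
theorem exists_symmetric_purification {d : Type*} [Fintype d] [DecidableEq d] {m : ℕ}
    (ρ : DensityMatrix (Fin m → d))
    (hρ : ∀ π : Equiv.Perm (Fin m), permOp d π * ρ.1 * (permOp d π).conjTranspose = ρ.1) :
    ∃ Ψ : Tensors (d × d) m, Ψ ∈ symSubspace (d × d) m ∧ ‖Ψ‖ = 1 ∧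
      traceAncilla (proj Ψ) = ρ.1 := by
  obtain ⟨R, hR⟩ : ∃ R, CFC.sqrt ρ.1 = R := ⟨_, rfl⟩
  have hRR : R * R = ρ.1 := hR ▸ CFC.sqrt_mul_sqrt_self ρ.1 ρ.2.1.nonneg
  have hpos : R.PosSemidef := Matrix.nonneg_iff_posSemidef.1 (hR ▸ CFC.sqrt_nonneg ρ.1)
  have hinv : ∀ π : Equiv.Perm (Fin m), R.submatrix (π.symm.arrowCongr (.refl d))
      (π.symm.arrowCongr (.refl d)) = R := by
    intro π
    have h0 := (hpos.submatrix (π.symm.arrowCongr (.refl d))).nonneg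
    have h1 : R.submatrix (π.symm.arrowCongr (.refl d)) (π.symm.arrowCongr (.refl d)) *
        R.submatrix (π.symm.arrowCongr (.refl d)) (π.symm.arrowCongr (.refl d)) = ρ.1 := by
      rw [Matrix.submatrix_mul_equiv, hRR, ← permOp_mul_mul_conjTranspose, hρ]
    rw [← CFC.sqrt_unique h1 h0, hR]
  have htr : traceAncilla (proj (WithLp.toLp 2 fun p : Fin m → d × d =>
      R (fun i => (p i).1) fun i => (p i).2)) = ρ.1 := by
    ext x y
    rw [← hRR, Matrix.mul_apply]
    simp only [traceAncilla, proj, Matrix.of_apply]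
    exact Finset.sum_congr rfl fun z _ => congrArg _ (hpos.isHermitian.apply _ _)
  refine ⟨_, mem_symSubspace_iff.2 fun σ p => ?_, ?_, htr⟩
  · have := congrFun₂ (hinv σ) (fun i => (p i).1) fun i => (p i).2
    simpa [Equiv.arrowCongr, Function.comp_def] using this
  · have h := trace_proj (WithLp.toLp 2 fun p : Fin m → d × d =>
      R (fun i => (p i).1) fun i => (p i).2)
    rw [← trace_traceAncilla, htr, ρ.2.2] at h
    rw [← sq_eq_sq₀ (norm_nonneg _) zero_le_one, one_pow]
    exact_mod_cast h.symm

/-! ### Tracing out the ancillas -/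

theorem append_pair {d r : Type*} {k n : ℕ} (x : Fin k → d) (z : Fin n → d) (u : Fin k → r)
    (v : Fin n → r) : (fun i => (Fin.append x z i, Fin.append u v i)) =
      Fin.append (fun i => (x i, u i)) fun i => (z i, v i) := by
  ext i : 1
  refine Fin.addCases (fun i => ?_) (fun i => ?_) i <;> simp

theorem traceLast_traceAncilla {d r : Type*} [Fintype d] [Fintype r] {k n : ℕ}
    (M : Matrix (Fin (k + n) → d × r) (Fin (k + n) → d × r) ℂ) :
    traceLast k n (traceAncilla M) = traceAncilla (traceLast k n M) := by
  ext x y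
  simp only [traceLast, traceAncilla, Matrix.of_apply]
  simp_rw [sum_append, append_pair]
  rw [Finset.sum_comm]
  simp_rw [sum_pairs]

/-- The operator `S ⊗ I` on `(ℂ^d ⊗ ℂ^r)^{⊗ m}`. -/
def ampliation {d : Type*} (r : Type*) [DecidableEq r] {m : ℕ}
    (S : Matrix (Fin m → d) (Fin m → d) ℂ) :
    Matrix (Fin m → d × r) (Fin m → d × r) ℂ :=
  (Matrix.kroneckerMap (· * ·) S (1 : Matrix (Fin m → r) (Fin m → r) ℂ)).submatrix
    (Equiv.arrowProdEquivProdArrow (Fin m) (fun _ => d) fun _ => r)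
    (Equiv.arrowProdEquivProdArrow (Fin m) (fun _ => d) fun _ => r)

theorem ampliation_apply {d r : Type*} [DecidableEq r] {m : ℕ}
    (S : Matrix (Fin m → d) (Fin m → d) ℂ) (x y : Fin m → d) (z w : Fin m → r) :
    ampliation r S (fun i => (x i, z i)) (fun i => (y i, w i)) =
      if z = w then S x y else 0 := by
  rw [← mul_boole, ← Matrix.one_apply]
  rfl

theorem isHermitian_ampliation {d r : Type*} [DecidableEq r] {m : ℕ}
    {S : Matrix (Fin m → d) (Fin m → d) ℂ} (hS : S.IsHermitian) :
    (ampliation r S).IsHermitian := by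
  refine Matrix.IsHermitian.submatrix ?_ _
  rw [Matrix.IsHermitian, Matrix.conjTranspose_kronecker, hS.eq, Matrix.conjTranspose_one]

theorem ampliation_mul_self {d r : Type*} [Fintype d] [DecidableEq d] [Fintype r] [DecidableEq r]
    {m : ℕ} {S : Matrix (Fin m → d) (Fin m → d) ℂ} (hS : S * S = 1) :
    ampliation r S * ampliation r S = 1 := by
  rw [ampliation, Matrix.submatrix_mul_equiv, ← Matrix.mul_kronecker_mul, hS,
    mul_one, Matrix.one_kronecker_one, Matrix.submatrix_one_equiv]

/-- Duality between the partial trace and `S ↦ S ⊗ I`; it lets a test operator on the reduced system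
be used upstairs. -/
theorem trace_mul_traceAncilla {d r : Type*} [Fintype d] [Fintype r] [DecidableEq r] {m : ℕ}
    (S : Matrix (Fin m → d) (Fin m → d) ℂ)
    (X : Matrix (Fin m → d × r) (Fin m → d × r) ℂ) :
    (S * traceAncilla X).trace = (ampliation r S * X).trace := by
  simp only [Matrix.trace, Matrix.diag, Matrix.mul_apply, traceAncilla, Matrix.of_apply,
    sum_pairs, ampliation_apply, ite_mul, zero_mul, Finset.sum_ite_eq, Finset.mem_univ, if_true,
    Finset.mul_sum]
  exact Finset.sum_congr rfl fun x _ => Finset.sum_comm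

/-- The partial trace over the second factor, on density matrices. -/
def DensityMatrix.reduce {d r : Type*} [Fintype d] [Fintype r] (σ : DensityMatrix (d × r)) :
    DensityMatrix d :=
  ⟨∑ z : r, σ.1.submatrix (fun i => (i, z)) fun i => (i, z),
    Matrix.posSemidef_sum _ fun z _ => σ.2.1.submatrix _, by
      refine Eq.trans ?_ σ.2.2
      simp only [Matrix.trace, Matrix.diag, Matrix.sum_apply, Matrix.submatrix_apply]
      rw [Fintype.sum_prod_type]⟩

theorem measurable_reduce {d r : Type*} [Fintype d] [Fintype r] :
    Measurable (DensityMatrix.reduce : DensityMatrix (d × r) → DensityMatrix d) := by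
  refine measurable_densityMatrix_iff.2 fun i j => ?_
  simp only [DensityMatrix.reduce, Matrix.sum_apply, Matrix.submatrix_apply]
  exact Finset.measurable_fun_sum _ fun z _ => measurable_entry _ _

/-- Expanding a product of sums over the ancilla letter gives a sum over ancilla words. -/
theorem matTensorPow_reduce {d r : Type*} [Fintype d] [Fintype r] (σ : DensityMatrix (d × r))
    (k : ℕ) : matTensorPow σ.reduce.1 k = traceAncilla (matTensorPow σ.1 k) := by
  ext x y
  simp only [matTensorPow, traceAncilla, DensityMatrix.reduce, Matrix.of_apply, Matrix.sum_apply,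
    Matrix.submatrix_apply]
  rw [Finset.prod_univ_sum, Fintype.piFinset_univ]

theorem mixture_map_reduce_outcomeLaw {d r : Type*} [Fintype d] [Fintype r] [Nonempty d]
    [Nonempty r] {k n : ℕ} (Ψ : Tensors (d × r) (k + n)) :
    mixture ((outcomeLaw k n Ψ).map DensityMatrix.reduce) k =
      traceAncilla (mixture (outcomeLaw k n Ψ) k) := by
  ext x y
  have hm := measurable_matTensorPow (d := d) x y
  have hmr : Measurable fun σ : DensityMatrix (d × r) => matTensorPow σ.reduce.1 k x y :=
    hm.comp measurable_reduce
  rw [mixture, Matrix.of_apply, integral_map measurable_reduce.aemeasurable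
    hm.aestronglyMeasurable, integral_outcomeLaw Ψ hmr]
  simp only [matTensorPow_reduce, matTensorPow_pureState, traceAncilla,
    Matrix.of_apply, mixture_outcomeLaw, Finset.mul_sum]
  refine integral_finsetSum _ fun z _ => integrable_unif ?_
  exact (Complex.continuous_ofReal.comp (continuous_outcomeDensity Ψ)).mul
    (continuous_proj (continuous_tensorPow_vec k) _ _)

theorem IsHermitian.traceAncilla {d r : Type*} [Fintype r] {m : ℕ}
    {M : Matrix (Fin m → d × r) (Fin m → d × r) ℂ} (hM : M.IsHermitian) :
    (traceAncilla M).IsHermitian := by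
  ext x y
  simp only [DeFinetti.traceAncilla, Matrix.conjTranspose_apply, Matrix.of_apply, star_sum]
  exact Finset.sum_congr rfl fun z _ => hM.apply _ _

theorem traceAncilla_sub {d r : Type*} [Fintype r] {m : ℕ}
    (M N : Matrix (Fin m → d × r) (Fin m → d × r) ℂ) :
    traceAncilla (M - N) = traceAncilla M - traceAncilla N := by
  ext x y
  simp [traceAncilla]

theorem traceDist_traceAncilla_le {d r : Type*} [Fintype d] [Fintype r] [Nonempty d] [Nonempty r]
    [DecidableEq d] [DecidableEq r] {k n : ℕ} {Ψ : Tensors (d × r) (k + n)}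
    (hΨ : Ψ ∈ symSubspace (d × r) (k + n)) (h1 : ‖Ψ‖ = 1) :
    traceDist (traceLast k n (traceAncilla (proj Ψ)))
        (mixture ((outcomeLaw k n Ψ).map DensityMatrix.reduce) k) ≤
      Real.sqrt (1 - avgFidelity (Fintype.card d * Fintype.card r) n k) := by
  rw [traceLast_traceAncilla, mixture_map_reduce_outcomeLaw, traceDist, ← traceAncilla_sub]
  obtain ⟨S, hS, hS2, h⟩ := exists_sign_matrix (IsHermitian.traceAncilla
    ((isHermitian_traceLast_proj Ψ).sub (isHermitian_mixture (outcomeLaw k n Ψ) k)))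
  rw [h, trace_mul_traceAncilla, ← Fintype.card_prod]
  exact re_trace_mul_sub_le hΨ h1 (isHermitian_ampliation hS) (ampliation_mul_self hS2)

/-! ### Assembly -/

theorem sqrt_one_sub_avgFidelity_le (D n k : ℕ) (hn : 0 < n) :
    Real.sqrt (1 - avgFidelity D n k) ≤ Real.sqrt ((k : ℝ) * D / n) :=
  Real.sqrt_le_sqrt (by linarith [one_sub_le_avgFidelity D n k hn])

/-- Both sides are the rank-one matrix of the same vector, so no division by the density occurs. -/
theorem outcomeDensity_mul_proj {d : Type*} [Fintype d] {k n : ℕ} {ψ : Tensors d (k + n)}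
    {φ : EuclideanSpace ℂ d} {v : Tensors d k}
    (hv : (Real.sqrt ((Fintype.card d + n - 1).choose (Fintype.card d - 1)) : ℂ) •
      contract k n ψ φ = (Real.sqrt (outcomeDensity k n ψ φ) : ℂ) • v) (x y : Fin k → d) :
    (outcomeDensity k n ψ φ : ℂ) * proj v x y =
      ((Fintype.card d + n - 1).choose (Fintype.card d - 1) : ℂ) *
        (contract k n ψ φ x * conj (contract k n ψ φ y)) := by
  have h : ∀ (t : ℝ) (w : Tensors d k), 0 ≤ t → (t : ℂ) * (w x * conj (w y)) =
      ((Real.sqrt t : ℂ) • w) x * conj (((Real.sqrt t : ℂ) • w) y) := by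
    intro t w ht
    have h2 : (t : ℂ) = Real.sqrt t * Real.sqrt t := by
      rw [← Complex.ofReal_mul, Real.mul_self_sqrt ht]
    simp only [PiLp.smul_apply, smul_eq_mul, map_mul, Complex.conj_ofReal]
    rw [h2]
    ring
  have h1 := h _ v (outcomeDensity_nonneg ψ φ)
  have h3 := h _ (contract k n ψ φ)
    (Nat.cast_nonneg ((Fintype.card d + n - 1).choose (Fintype.card d - 1)))
  rw [hv, ← h1, Complex.ofReal_natCast] at h3
  exact h3.symm

theorem outcomeDensity_mul_norm_inner_sq {d : Type*} [Fintype d] {k n : ℕ}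
    {ψ : Tensors d (k + n)} {φ : EuclideanSpace ℂ d} {v : Tensors d k}
    (hv : (Real.sqrt ((Fintype.card d + n - 1).choose (Fintype.card d - 1)) : ℂ) •
      contract k n ψ φ = (Real.sqrt (outcomeDensity k n ψ φ) : ℂ) • v) (e : Tensors d k) :
    outcomeDensity k n ψ φ * ‖inner ℂ v e‖ ^ 2 =
      ((Fintype.card d + n - 1).choose (Fintype.card d - 1) : ℝ) *
        ‖inner ℂ (contract k n ψ φ) e‖ ^ 2 := by
  have h : ∀ (t : ℝ) (w : Tensors d k), 0 ≤ t → t * ‖inner ℂ w e‖ ^ 2 =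
      ‖inner ℂ ((Real.sqrt t : ℂ) • w) e‖ ^ 2 := by
    intro t w ht
    rw [inner_smul_left, norm_mul, mul_pow, RCLike.norm_conj, Complex.norm_real,
      Real.norm_of_nonneg (Real.sqrt_nonneg _), Real.sq_sqrt ht]
  rw [h _ _ (outcomeDensity_nonneg ψ φ), h _ _ (Nat.cast_nonneg _), hv]

end DeFinetti

open DeFinetti in
theorem mainTheorem1 (D n k : ℕ) (hn : 0 < n) :
    -- symmetric pure states
    (∀ ψ : Tensors (Fin D) (k + n), ψ ∈ symSubspace (Fin D) (k + n) → ‖ψ‖ = 1 →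
      IsProbabilityMeasure (outcomeLaw k n ψ) ∧
      (∃ v : UnitVectors (Fin D) → Tensors (Fin D) k,
        Measurable v ∧ (∀ φ, ‖v φ‖ = 1) ∧
        (∀ φ, (Real.sqrt ((D + n - 1).choose (D - 1)) : ℂ) • contract k n ψ φ.1 =
          (Real.sqrt (outcomeDensity k n ψ φ.1) : ℂ) • v φ) ∧
        traceLast k n (proj ψ) =
          Matrix.of (fun x y =>
            ∫ φ, (outcomeDensity k n ψ φ.1 : ℂ) * proj (v φ) x y ∂(unif (Fin D))) ∧
        ∫ φ, outcomeDensity k n ψ φ.1 * ‖inner ℂ (v φ) (tensorPow φ.1 k)‖ ^ 2 ∂(unif (Fin D))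
          = avgFidelity D n k) ∧
      avgFidelity D n k ≥ 1 - (k : ℝ) * D / n ∧
      traceDist (traceLast k n (proj ψ)) (mixture (outcomeLaw k n ψ) k)
        ≤ Real.sqrt (1 - avgFidelity D n k) ∧
      traceDist (traceLast k n (proj ψ)) (mixture (outcomeLaw k n ψ) k)
        ≤ Real.sqrt ((k : ℝ) * D / n)) ∧
    -- permutation-invariant mixed states
    (∀ ρ : DensityMatrix (Fin (k + n) → Fin D),
      (∀ π : Equiv.Perm (Fin (k + n)),
        permOp (Fin D) π * ρ.1 * (permOp (Fin D) π).conjTranspose = ρ.1) →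
      (∃ Ψ : Tensors (Fin D × Fin D) (k + n),
        Ψ ∈ symSubspace (Fin D × Fin D) (k + n) ∧ ‖Ψ‖ = 1 ∧ traceAncilla (proj Ψ) = ρ.1) ∧
      (∃ μ : Measure (DensityMatrix (Fin D)), IsProbabilityMeasure μ ∧
        traceDist (traceLast k n ρ.1) (mixture μ k)
          ≤ Real.sqrt (1 - avgFidelity (D ^ 2) n k) ∧
        traceDist (traceLast k n ρ.1) (mixture μ k)
          ≤ Real.sqrt ((k : ℝ) * (D : ℝ) ^ 2 / n))) := by
  -- This excludes `D = 0`: since `n > 0`, there are then no words of length `k + n`, hence no unit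
  -- vectors.
  have aux : ∀ {ι : Type} [IsEmpty ι] [Fintype ι] (ψ : EuclideanSpace ℂ ι), ‖ψ‖ ≠ 1 := by
    intro ι _ _ ψ h
    simp [Subsingleton.elim ψ 0] at h
  refine ⟨fun ψ hψ h1 => ?_, fun ρ hρ => ?_⟩
  · have : Nonempty (Fin D) := by
      by_contra hD
      have := not_nonempty_iff.1 hD
      have : Nonempty (Fin (k + n)) := ⟨⟨k, by omega⟩⟩
      exact aux ψ h1
    have hle := traceDist_traceLast_proj_le hψ h1
    have hT := fun x y => integral_contract_mul_conj hψ x y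
    have hF := integral_norm_inner_sq hψ h1
    obtain ⟨v, hvm, hv1, hv⟩ := exists_measurable_normalized ψ
    simp only [Fintype.card_fin] at hle hF
    refine ⟨isProbabilityMeasure_outcomeLaw hψ h1, ⟨v, hvm, hv1, ?_, ?_, ?_⟩,
      one_sub_le_avgFidelity D n k hn, hle, hle.trans (sqrt_one_sub_avgFidelity_le D n k hn)⟩
    · simpa only [Fintype.card_fin] using hv
    · ext x y
      rw [Matrix.of_apply, ← hT, ← integral_const_mul]
      exact integral_congr_ae (.of_forall fun φ => (outcomeDensity_mul_proj (hv φ) x y).symm)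
    · rw [← hF, ← integral_const_mul]
      refine integral_congr_ae (.of_forall fun φ => ?_)
      simpa only [Fintype.card_fin] using outcomeDensity_mul_norm_inner_sq (hv φ) _
  · obtain ⟨Ψ, hΨ, h1, hΨρ⟩ := exists_symmetric_purification ρ hρ
    have : Nonempty (Fin D) := by
      by_contra hD
      have := not_nonempty_iff.1 hD
      have : Nonempty (Fin (k + n)) := ⟨⟨k, by omega⟩⟩
      exact aux Ψ h1
    have hle := traceDist_traceAncilla_le hΨ h1
    rw [hΨρ, Fintype.card_fin, ← sq] at hle
    have := isProbabilityMeasure_outcomeLaw hΨ h1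
    refine ⟨⟨Ψ, hΨ, h1, hΨρ⟩, _,
      Measure.isProbabilityMeasure_map measurable_reduce.aemeasurable, hle, hle.trans ?_⟩
    have := sqrt_one_sub_avgFidelity_le (D ^ 2) n k hn
    rwa [Nat.cast_pow] at this
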